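/- Let $1 \le C < L$ be integers and let $\mu_1 > \mu_2 > \cdots > \mu_L \ge 0$ with $\sum_{i=1}^L \mu_i = 1$. Let the requests $x(1), x(2), \ldots$ be i.i.d. with values in $\{1,\ldots,L\}$ and $\mathbb{P}(x(t)=i)=\mu_i$. For $t \ge 1$ put $\hat\mu_i(t) = \frac1t \sum_{\tau=1}^{t} \mathbf{1}\{x(\tau)=i\}$, and $\hat\mu_i(0)=0$. The LFU algorithm with cache size $C$ uses, at each time $t+1$ with $t \ge 0$, a cache $C(t+1) \subseteq \{1,\ldots,L\}$ consisting of $C$ items whose values $\hat\mu_i(t)$ are the $C$ largest; that is, $|C(t+1)| = C$ and $\hat\mu_j(t) \le \hat\mu_i(t)$ for all $i \in C(t+1)$, $j \notin C(t+1)$. Ties (in particular the choice of $C(1)$) are broken arbitrarily, as a measurable function of $x(1),\ldots,x(t)$ and possibly of a random seed independent of all requests. Define the regret $$R(T) = \sum_{t=1}^{T} \left( \mathbf{1}\{x(t) \in \{1,\ldots,C\}\} - \mathbf{1}\{x(t) \in C(t)\} \right).$$ Then, with $\Delta_{\min} = \mu_C - \mu_{C+1}$, for every integer $T \ge 0$,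 $$\mathbb{E}[R(T)] < \min\left( \frac{16}{\Delta_{\min}^2}, \frac{4C(L-C)}{\Delta_{\min}} \right).$$ In particular, the expected regret of LFU is $O(1)$ as $T \to \infty$. -/

import Mathlib

open MeasureTheory ProbabilityTheory

/-- Empirical popularity of item `i` in a list `h` of `n` requests,
`(1/n) ∑_τ 1{h τ = i}`; it is `0` for every item when `n = 0`. -/
noncomputable def empiricalFreq {L n : ℕ} (h : Fin n → Fin L) (i : Fin L) : ℝ :=
  (1 / (n : ℝ)) * ∑ τ : Fin n, if h τ = i then (1 : ℝ) else 0

/-- `S` is a set of indices of the top `C` entries of the vector `v`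
(several sets qualify when there are ties). -/
def IsTopSet {L : ℕ} (C : ℕ) (v : Fin L → ℝ) (S : Finset (Fin L)) : Prop :=
  S.card = C ∧ ∀ i ∈ S, ∀ j ∉ S, v j ≤ v i

/-- A caching policy under full observation with internal randomness in `𝓤`: from the `n` requests
at times `1, …, n` and the seed it selects the cache content for time `n + 1`. -/
abbrev CachingPolicy (L : ℕ) (𝓤 : Type*) : Type _ :=
  (n : ℕ) → (Fin n → Fin L) → 𝓤 → Finset (Fin L)

/-- LFU with cache size `C`: the cache always holds the top `C` items for the empirical
popularities of all past requests. Ties are broken in an arbitrary, possibly randomized,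
(measurable) way that may depend on the past requests. -/
structure IsLFU {L : ℕ} {𝓤 : Type*} [MeasurableSpace 𝓤] (C : ℕ) (π : CachingPolicy L 𝓤) :
    Prop where
  measurable : ∀ (n : ℕ) (h : Fin n → Fin L) (S : Finset (Fin L)), MeasurableSet {u | π n h u = S}
  top : ∀ (n : ℕ) (h : Fin n → Fin L) (u : 𝓤), IsTopSet C (empiricalFreq h) (π n h u)

/-- The cache content at time `n + 1` for the request sequence `r`, where `r k` is the request
at time `k + 1`. -/
def cacheAt {L : ℕ} {𝓤 : Type*} (π : CachingPolicy L 𝓤) (u : 𝓤) (r : ℕ → Fin L) (n : ℕ) :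
    Finset (Fin L) :=
  π n (fun τ : Fin n => r τ) u

/-- The optimal cache content: the first `C` items. -/
def optimalCache (L C : ℕ) : Finset (Fin L) :=
  Finset.univ.filter fun i => i.val < C

/-- Cumulative regret over the times `1, …, T` on the request sequence `r`. -/
noncomputable def regret {L : ℕ} {𝓤 : Type*} (C : ℕ) (π : CachingPolicy L 𝓤) (u : 𝓤)
    (r : ℕ → Fin L) (T : ℕ) : ℝ :=
  ∑ n ∈ Finset.range T,
    ((if r n ∈ optimalCache L C then (1 : ℝ) else 0) -
      (if r n ∈ cacheAt π u r n then (1 : ℝ) else 0))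

/-- `μ_C - μ_{C+1}` in one-based numbering of the items. -/
def deltaMin {L : ℕ} (μ : Fin L → ℝ) (C : ℕ) (hCL : C < L) : ℝ :=
  μ ⟨C - 1, by omega⟩ - μ ⟨C, hCL⟩

/-!
The cache used at time `n + 1` is a function of the seed and the first `n` requests, hence
independent of request `n + 1`. So the expected regret at that time is the expected loss in hit
probability `hitGap` of that cache, which is bounded in two ways. Write `v` for the vector of
empirical frequencies after `n` requests.

* Caching a wrong set requires some `j` outside the optimal cache to look at least as popular as
  some `i` inside it, which forces `Δ ^ 2 ≤ 2 * ‖v - μ‖ ^ 2`. As `v - μ` is `1 / n` times a sum of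
  `n` i.i.d. mean-zero vectors, `E ‖v - μ‖ ^ 4 ≤ 5 / n ^ 2`. Hence the loss, which is at most `1`,
  is also `O(1 / (Δ ^ 4 * n ^ 2))`, and summing the smaller of the two bounds gives `O(1 / Δ ^ 2)`.
* The loss is at most the sum of `μ i - μ j` over the pairs `(i, j)` that `v` puts in the wrong
  order. With `d = μ i - μ j`, Hoeffding's inequality bounds the probability of that event by
  `exp (-n * d ^ 2 / 2)`, and the geometric series gives at most `d * (1 + 2 / d ^ 2) ≤ 3 / d`
  per pair.
-/

section FiniteValued

variable {Ω : Type*} [MeasurableSpace Ω] {P : Measure Ω} [IsFiniteMeasure P]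

theorem indepFun_prodMk_left_of_indepFun_prodMk_right {α β γ : Type*} [MeasurableSpace α]
    [MeasurableSpace β] [MeasurableSpace γ] {X : Ω → α} {Y : Ω → β} {Z : Ω → γ}
    (hX : Measurable X) (hY : Measurable Y) (hZ : Measurable Z)
    (hXYZ : IndepFun X (fun ω => (Y ω, Z ω)) P) (hYZ : IndepFun Y Z P) :
    IndepFun (fun ω => (X ω, Y ω)) Z P := by
  have hXY : IndepFun X Y P := hXYZ.comp measurable_id measurable_fst
  rw [indepFun_iff_map_prod_eq_prod_map_map (by fun_prop) (by fun_prop)] at *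
  apply MeasurableEquiv.prodAssoc.map_measurableEquiv_injective
  rw [hXY, Measure.prodAssoc_prod, ← hYZ, ← hXYZ, Measure.map_map (by fun_prop) (by fun_prop)]
  rfl

theorem memLp_comp_of_finite {E α : Type*} [NormedAddCommGroup E] [Finite α] [MeasurableSpace α]
    [MeasurableSingletonClass α] {A : Ω → α} (hA : Measurable A) (f : α → E) {p : ENNReal} :
    MemLp (fun ω => f (A ω)) p P :=
  MemLp.of_discrete.comp_of_map hA.aemeasurable

theorem integrable_comp_of_finite {E α : Type*} [NormedAddCommGroup E] [Finite α]
    [MeasurableSpace α] [MeasurableSingletonClass α] {A : Ω → α} (hA : Measurable A) (f : α → E) :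
    Integrable (fun ω => f (A ω)) P :=
  memLp_one_iff_integrable.1 (memLp_comp_of_finite hA f)

theorem integral_sum_sum_mul_ite {ι κ : Type*} (s : Finset ι) (t : Finset κ) (c : ι → κ → ℝ)
    {p : ι → κ → Ω → Prop} [∀ i j, DecidablePred (p i j)]
    (hp : ∀ i j, MeasurableSet {ω | p i j ω}) :
    ∫ ω, ∑ i ∈ s, ∑ j ∈ t, c i j * (if p i j ω then 1 else 0) ∂P =
      ∑ i ∈ s, ∑ j ∈ t, c i j * P.real {ω | p i j ω} := by
  have hite : ∀ i j, (fun ω => if p i j ω then (1 : ℝ) else 0) = {ω | p i j ω}.indicator 1 :=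
    fun i j => by
      ext ω
      simp [Set.indicator_apply]
  have hint : ∀ i j, Integrable (fun ω => c i j * if p i j ω then 1 else 0) P := fun i j => by
    refine Integrable.const_mul ?_ _
    rw [hite]
    exact (integrable_const 1).indicator (hp i j)
  rw [integral_finsetSum _ fun i _ => integrable_finsetSum _ fun j _ => hint i j]
  refine Finset.sum_congr rfl fun i _ => ?_
  rw [integral_finsetSum _ fun j _ => hint i j]
  refine Finset.sum_congr rfl fun j _ => ?_
  rw [integral_const_mul, hite, integral_indicator_one (hp i j)]

variable {ι : Type*} [Fintype ι] [MeasurableSpace ι] [MeasurableSingletonClass ι] {Y : Ω → ι}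

theorem integral_comp_eq_sum_smul {E : Type*} [NormedAddCommGroup E] [NormedSpace ℝ E]
    [CompleteSpace E] (hY : Measurable Y) (f : ι → E) :
    ∫ ω, f (Y ω) ∂P = ∑ i, P.real {ω | Y ω = i} • f i := by
  rw [← integral_map hY.aemeasurable Integrable.of_finite.aestronglyMeasurable,
    integral_fintype .of_finite]
  refine Finset.sum_congr rfl fun i _ => ?_
  rw [map_measureReal_apply hY (measurableSet_singleton i)]
  rfl

theorem integral_comp_comp_eq_integral_sum_smul_of_indepFun {E : Type*} [NormedAddCommGroup E]
    [NormedSpace ℝ E] [CompleteSpace E] {α : Type*} [Finite α] [MeasurableSpace α]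
    [MeasurableSingletonClass α] {A : Ω → α} (h : IndepFun A Y P) (hA : Measurable A)
    (hY : Measurable Y) (F : α → ι → E) :
    ∫ ω, F (A ω) (Y ω) ∂P = ∫ ω, ∑ i, P.real {ω | Y ω = i} • F (A ω) i ∂P := by
  calc ∫ ω, F (A ω) (Y ω) ∂P
      = ∫ z, F z.1 z.2 ∂((P.map A).prod (P.map Y)) := by
        rw [← h.map_prod_eq_prod_map_map hA.aemeasurable hY.aemeasurable,
          integral_map (by fun_prop) Integrable.of_finite.aestronglyMeasurable]
    _ = ∫ a, ∫ y, F a y ∂P.map Y ∂P.map A := integral_prod _ .of_finite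
    _ = ∫ a, ∑ i, P.real {ω | Y ω = i} • F a i ∂P.map A := by
        refine integral_congr_ae (.of_forall fun a => ?_)
        dsimp only
        rw [integral_map hY.aemeasurable Integrable.of_finite.aestronglyMeasurable,
          integral_comp_eq_sum_smul hY]
    _ = _ := integral_map hA.aemeasurable Integrable.of_finite.aestronglyMeasurable

theorem sum_measureReal_eq_one [IsProbabilityMeasure P] (hY : Measurable Y) :
    ∑ i, P.real {ω | Y ω = i} = 1 := by
  simpa using (integral_comp_eq_sum_smul (P := P) hY fun _ => (1 : ℝ)).symm

end FiniteValued

section FourthMoment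

variable {Ω : Type*} [MeasurableSpace Ω] {P : Measure Ω}
  {E : Type*} [NormedAddCommGroup E] [InnerProductSpace ℝ E]

theorem norm_add_pow_four_le (x y : E) :
    ‖x + y‖ ^ 4 ≤ ‖x‖ ^ 4 + 6 * (‖x‖ ^ 2 * ‖y‖ ^ 2) + ‖y‖ ^ 4 +
      (4 * inner ℝ (‖x‖ ^ 2 • x) y + 4 * inner ℝ x (‖y‖ ^ 2 • y)) := by
  have hcs : inner ℝ x y ^ 2 ≤ ‖x‖ ^ 2 * ‖y‖ ^ 2 := by
    rw [← mul_pow]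
    exact sq_le_sq.2 ((abs_real_inner_le_norm x y).trans (le_abs_self _))
  rw [real_inner_smul_left, real_inner_smul_right]
  calc ‖x + y‖ ^ 4 = (‖x‖ ^ 2 + 2 * inner ℝ x y + ‖y‖ ^ 2) ^ 2 := by
        rw [← norm_add_sq_real]
        ring
    _ ≤ _ := by linarith

theorem integrable_norm_sq_smul {X : Ω → E} (hX : MemLp X 3 P) :
    Integrable (fun ω => ‖X ω‖ ^ 2 • X ω) P := by
  refine (hX.integrable_norm_pow three_ne_zero).mono ((hX.1.norm.pow 2).smul hX.1)
    (.of_forall fun ω => le_of_eq ?_)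
  rw [norm_smul, norm_pow, norm_pow, norm_norm, pow_succ _ 2]

variable [MeasurableSpace E] [BorelSpace E] {X Y : Ω → E}

theorem integrable_inner_of_indepFun (h : IndepFun X Y P) (hX : Integrable X P)
    (hY : Integrable Y P) : Integrable (fun ω => inner ℝ (X ω) (Y ω)) P :=
  h.integrable_bilin hX hY (innerSL ℝ)

variable [CompleteSpace E]

theorem integral_inner_of_indepFun (h : IndepFun X Y P) (hX : Integrable X P)
    (hY : Integrable Y P) : ∫ ω, inner ℝ (X ω) (Y ω) ∂P = inner ℝ (∫ ω, X ω ∂P) (∫ ω, Y ω ∂P) :=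
  h.integral_bilin hX hY (innerSL ℝ)

theorem integral_norm_add_sq_of_indepFun [IsFiniteMeasure P] (h : IndepFun X Y P)
    (hX : MemLp X 2 P) (hY : MemLp Y 2 P) (hX0 : ∫ ω, X ω ∂P = 0) :
    ∫ ω, ‖X ω + Y ω‖ ^ 2 ∂P = ∫ ω, ‖X ω‖ ^ 2 ∂P + ∫ ω, ‖Y ω‖ ^ 2 ∂P := by
  have hX1 := hX.integrable one_le_two
  have hY1 := hY.integrable one_le_two
  have hXY := (integrable_inner_of_indepFun h hX1 hY1).const_mul 2
  simp_rw [norm_add_sq_real]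
  rw [integral_add (hX.integrable_norm_pow'.fun_add hXY) hY.integrable_norm_pow',
    integral_add hX.integrable_norm_pow' hXY, integral_const_mul,
    integral_inner_of_indepFun h hX1 hY1, hX0, inner_zero_left, mul_zero, add_zero]

theorem integral_norm_add_pow_four_le_of_indepFun [IsFiniteMeasure P] (h : IndepFun X Y P)
    (hX : MemLp X 4 P) (hY : MemLp Y 4 P) (hX0 : ∫ ω, X ω ∂P = 0) (hY0 : ∫ ω, Y ω ∂P = 0) :
    ∫ ω, ‖X ω + Y ω‖ ^ 4 ∂P ≤ ∫ ω, ‖X ω‖ ^ 4 ∂P +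
      6 * ((∫ ω, ‖X ω‖ ^ 2 ∂P) * ∫ ω, ‖Y ω‖ ^ 2 ∂P) + ∫ ω, ‖Y ω‖ ^ 4 ∂P := by
  have hX1 := hX.integrable (by norm_num)
  have hY1 := hY.integrable (by norm_num)
  have hX2 := (hX.mono_exponent (p := 2) (by norm_num)).integrable_norm_pow'
  have hY2 := (hY.mono_exponent (p := 2) (by norm_num)).integrable_norm_pow'
  have hX3 := integrable_norm_sq_smul (hX.mono_exponent (by norm_num))
  have hY3 := integrable_norm_sq_smul (hY.mono_exponent (by norm_num))
  have hX4 := hX.integrable_norm_pow'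
  have hY4 := hY.integrable_norm_pow'
  have hind22 : IndepFun (fun ω => ‖X ω‖ ^ 2) (fun ω => ‖Y ω‖ ^ 2) P :=
    h.comp (φ := (‖·‖ ^ 2)) (ψ := (‖·‖ ^ 2)) (by fun_prop) (by fun_prop)
  have hind31 : IndepFun (fun ω => ‖X ω‖ ^ 2 • X ω) Y P :=
    h.comp (φ := fun x => ‖x‖ ^ 2 • x) (by fun_prop) measurable_id
  have hind13 : IndepFun X (fun ω => ‖Y ω‖ ^ 2 • Y ω) P :=
    h.comp (ψ := fun y => ‖y‖ ^ 2 • y) measurable_id (by fun_prop)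
  have hint22 : Integrable (fun ω => 6 * (‖X ω‖ ^ 2 * ‖Y ω‖ ^ 2)) P :=
    (hind22.integrable_mul hX2 hY2).const_mul 6
  have hint31 := (integrable_inner_of_indepFun hind31 hX3 hY1).const_mul 4
  have hint13 := (integrable_inner_of_indepFun hind13 hX1 hY3).const_mul 4
  calc ∫ ω, ‖X ω + Y ω‖ ^ 4 ∂P
      ≤ ∫ ω, (‖X ω‖ ^ 4 + 6 * (‖X ω‖ ^ 2 * ‖Y ω‖ ^ 2) + ‖Y ω‖ ^ 4 +
          (4 * inner ℝ (‖X ω‖ ^ 2 • X ω) (Y ω) + 4 * inner ℝ (X ω) (‖Y ω‖ ^ 2 • Y ω))) ∂P :=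
        integral_mono (hX.add hY).integrable_norm_pow'
          (((hX4.fun_add hint22).fun_add hY4).fun_add (hint31.fun_add hint13))
          fun ω => norm_add_pow_four_le _ _
    _ = _ := by
        rw [integral_add ((hX4.fun_add hint22).fun_add hY4) (hint31.fun_add hint13),
          integral_add (hX4.fun_add hint22) hY4, integral_add hX4 hint22,
          integral_add hint31 hint13, integral_const_mul, integral_const_mul, integral_const_mul,
          hind22.integral_fun_mul_eq_mul_integral hX2.1 hY2.1,
          integral_inner_of_indepFun hind31 hX3 hY1, integral_inner_of_indepFun hind13 hX1 hY3,
          hX0, hY0, inner_zero_left, inner_zero_right, mul_zero, add_zero, add_zero]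

variable [SecondCountableTopology E] {κ : Type*} {Z : κ → Ω → E}

theorem integral_norm_sum_sq_of_iIndepFun (h : iIndepFun Z P) (hZ : ∀ k, Measurable (Z k))
    (hLp : ∀ k, MemLp (Z k) 2 P) (h0 : ∀ k, ∫ ω, Z k ω ∂P = 0) (s : Finset κ) :
    ∫ ω, ‖∑ k ∈ s, Z k ω‖ ^ 2 ∂P = ∑ k ∈ s, ∫ ω, ‖Z k ω‖ ^ 2 ∂P := by
  have := h.isProbabilityMeasure
  induction s using Finset.cons_induction with
  | empty => simp
  | cons k s hk ih =>
    have hindep := (h.indepFun_finsetSum_of_notMem hZ hk).symm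
    rw [Finset.sum_fn] at hindep
    simp_rw [Finset.sum_cons]
    rw [integral_norm_add_sq_of_indepFun hindep (hLp k) (memLp_finsetSum s fun i _ => hLp i) (h0 k),
      ih]

theorem integral_norm_sum_pow_four_le_of_iIndepFun (h : iIndepFun Z P)
    (hZ : ∀ k, Measurable (Z k)) (hLp : ∀ k, MemLp (Z k) 4 P) (h0 : ∀ k, ∫ ω, Z k ω ∂P = 0)
    (s : Finset κ) :
    ∫ ω, ‖∑ k ∈ s, Z k ω‖ ^ 4 ∂P ≤
      3 * (∑ k ∈ s, ∫ ω, ‖Z k ω‖ ^ 2 ∂P) ^ 2 + ∑ k ∈ s, ∫ ω, ‖Z k ω‖ ^ 4 ∂P := by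
  have := h.isProbabilityMeasure
  induction s using Finset.cons_induction with
  | empty => simp
  | cons k s hk ih =>
    have hindep := (h.indepFun_finsetSum_of_notMem hZ hk).symm
    rw [Finset.sum_fn] at hindep
    have hLp2 : ∀ k, MemLp (Z k) 2 P := fun k => (hLp k).mono_exponent (by norm_num)
    have hsum0 : ∫ ω, ∑ i ∈ s, Z i ω ∂P = 0 := by
      rw [integral_finsetSum s fun i _ => (hLp i).integrable (by norm_num)]
      exact Finset.sum_eq_zero fun i _ => h0 i
    have hstep := integral_norm_add_pow_four_le_of_indepFun hindep (hLp k)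
      (memLp_finsetSum s fun i _ => hLp i) (h0 k) hsum0
    rw [integral_norm_sum_sq_of_iIndepFun h hZ hLp2 h0] at hstep
    simp_rw [Finset.sum_cons]
    linarith [sq_nonneg (∫ ω, ‖Z k ω‖ ^ 2 ∂P)]

end FourthMoment

section CenteredIndicator

variable {ι : Type*} [Fintype ι] [DecidableEq ι]

/-- The indicator vector of `k` in the standard basis, centred at `μ`. When `k` is random with
law `μ`, this is a mean-zero random vector, and its partial sums over independent copies are the
deviations of the counts from their expectations. -/
noncomputable def centeredIndicator (μ : ι → ℝ) (k : ι) : EuclideanSpace ℝ ι :=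
  EuclideanSpace.single k 1 - WithLp.toLp 2 μ

variable {μ : ι → ℝ}

theorem norm_sq_centeredIndicator (μ : ι → ℝ) (k : ι) :
    ‖centeredIndicator μ k‖ ^ 2 = 1 - 2 * μ k + ∑ i, μ i ^ 2 := by
  rw [centeredIndicator, norm_sub_sq_real, PiLp.norm_single,
    EuclideanSpace.inner_single_left, EuclideanSpace.real_norm_sq_eq]
  simp

theorem sum_mul_norm_sq_centeredIndicator (hμ1 : ∑ i, μ i = 1) :
    ∑ k, μ k * ‖centeredIndicator μ k‖ ^ 2 = 1 - ∑ i, μ i ^ 2 := by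
  have hterm : ∀ k, μ k * ‖centeredIndicator μ k‖ ^ 2 =
      (1 + ∑ i, μ i ^ 2) * μ k - 2 * μ k ^ 2 := fun k => by
    rw [norm_sq_centeredIndicator]
    ring
  simp_rw [hterm]
  rw [Finset.sum_sub_distrib, ← Finset.mul_sum, ← Finset.mul_sum, hμ1]
  ring

theorem norm_sq_centeredIndicator_le_two (hμ0 : ∀ i, 0 ≤ μ i) (hμ1 : ∑ i, μ i = 1) (k : ι) :
    ‖centeredIndicator μ k‖ ^ 2 ≤ 2 := by
  have hle : ∀ i, μ i ≤ 1 := fun i =>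
    hμ1 ▸ Finset.single_le_sum (fun j _ => hμ0 j) (Finset.mem_univ i)
  have hsq : ∑ i, μ i ^ 2 ≤ 1 :=
    hμ1 ▸ Finset.sum_le_sum fun i _ => pow_le_of_le_one (hμ0 i) (hle i) two_ne_zero
  rw [norm_sq_centeredIndicator]
  linarith [hμ0 k]

theorem toLp_empiricalFreq_sub_toLp {L n : ℕ} (hn : n ≠ 0) (μ : Fin L → ℝ) (h : Fin n → Fin L) :
    WithLp.toLp 2 (empiricalFreq h) - WithLp.toLp 2 μ =
      (n : ℝ)⁻¹ • ∑ τ, centeredIndicator μ (h τ) := by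
  ext i
  have hn' : (n : ℝ) ≠ 0 := Nat.cast_ne_zero.2 hn
  simp [empiricalFreq, centeredIndicator, Pi.single_apply, mul_sub, hn', eq_comm]

variable {Ω : Type*} [MeasurableSpace Ω] {P : Measure Ω} [IsProbabilityMeasure P]
  [MeasurableSpace ι] [MeasurableSingletonClass ι] {Y : Ω → ι}

theorem integral_centeredIndicator (hY : Measurable Y) (hlaw : ∀ i, P.real {ω | Y ω = i} = μ i) :
    ∫ ω, centeredIndicator μ (Y ω) ∂P = 0 := by
  have hsum := sum_measureReal_eq_one (P := P) hY
  rw [integral_comp_eq_sum_smul hY]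
  simp_rw [hlaw] at hsum ⊢
  ext i
  simp [centeredIndicator, mul_sub, Pi.single_apply, ← Finset.sum_mul, hsum]

theorem integral_norm_sq_centeredIndicator_le_one (hY : Measurable Y)
    (hlaw : ∀ i, P.real {ω | Y ω = i} = μ i) :
    ∫ ω, ‖centeredIndicator μ (Y ω)‖ ^ 2 ∂P ≤ 1 := by
  have hsum := sum_measureReal_eq_one (P := P) hY
  rw [integral_comp_eq_sum_smul hY fun k => ‖centeredIndicator μ k‖ ^ 2]
  simp_rw [hlaw, smul_eq_mul] at hsum ⊢
  rw [sum_mul_norm_sq_centeredIndicator hsum]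
  exact sub_le_self _ (Finset.sum_nonneg fun i _ => sq_nonneg _)

theorem integral_norm_pow_four_centeredIndicator_le_two (hY : Measurable Y)
    (hlaw : ∀ i, P.real {ω | Y ω = i} = μ i) :
    ∫ ω, ‖centeredIndicator μ (Y ω)‖ ^ 4 ∂P ≤ 2 := by
  have hsum := sum_measureReal_eq_one (P := P) hY
  simp_rw [hlaw] at hsum
  have hpos : ∀ i, 0 ≤ μ i := fun i => hlaw i ▸ measureReal_nonneg
  calc ∫ ω, ‖centeredIndicator μ (Y ω)‖ ^ 4 ∂P
      ≤ ∫ ω, 2 * ‖centeredIndicator μ (Y ω)‖ ^ 2 ∂P := by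
        refine integral_mono (integrable_comp_of_finite hY fun k => ‖centeredIndicator μ k‖ ^ 4)
          (integrable_comp_of_finite hY fun k => 2 * ‖centeredIndicator μ k‖ ^ 2) fun ω => ?_
        calc ‖centeredIndicator μ (Y ω)‖ ^ 4
            = ‖centeredIndicator μ (Y ω)‖ ^ 2 * ‖centeredIndicator μ (Y ω)‖ ^ 2 := by ring
          _ ≤ _ := by
            gcongr
            exact norm_sq_centeredIndicator_le_two hpos hsum _
    _ ≤ 2 := by
        rw [integral_const_mul]
        linarith [integral_norm_sq_centeredIndicator_le_one hY hlaw]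

theorem integral_norm_sum_centeredIndicator_pow_four_le {κ : Type*} {x : κ → Ω → ι}
    (hx : ∀ k, Measurable (x k)) (hlaw : ∀ k i, P.real {ω | x k ω = i} = μ i)
    (hindep : iIndepFun x P) (s : Finset κ) :
    ∫ ω, ‖∑ k ∈ s, centeredIndicator μ (x k ω)‖ ^ 4 ∂P ≤ 3 * (s.card : ℝ) ^ 2 + 2 * s.card := by
  have hmeas : Measurable (centeredIndicator μ) := measurable_of_finite _
  have hfour := integral_norm_sum_pow_four_le_of_iIndepFun
    (hindep.comp (fun _ => centeredIndicator μ) fun _ => hmeas) (fun k => hmeas.comp (hx k))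
    (fun k => memLp_comp_of_finite (hx k) _) (fun k => integral_centeredIndicator (hx k) (hlaw k)) s
  refine hfour.trans (add_le_add (mul_le_mul_of_nonneg_left (pow_le_pow_left₀ ?_ ?_ 2) ?_) ?_)
  · exact Finset.sum_nonneg fun k _ => integral_nonneg fun ω => sq_nonneg _
  · simpa using Finset.sum_le_sum fun k (_ : k ∈ s) =>
      integral_norm_sq_centeredIndicator_le_one (hx k) (hlaw k)
  · norm_num
  · simpa [mul_comm] using Finset.sum_le_sum fun k (_ : k ∈ s) =>
      integral_norm_pow_four_centeredIndicator_le_two (hx k) (hlaw k)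

theorem integral_norm_empiricalFreq_sub_pow_four_le {L : ℕ} {μ : Fin L → ℝ} {x : ℕ → Ω → Fin L}
    (hx : ∀ k, Measurable (x k)) (hlaw : ∀ k i, P.real {ω | x k ω = i} = μ i)
    (hindep : iIndepFun x P) {n : ℕ} (hn : n ≠ 0) :
    ∫ ω, ‖WithLp.toLp 2 (empiricalFreq fun τ : Fin n => x τ ω) - WithLp.toLp 2 μ‖ ^ 4 ∂P ≤
      5 / (n : ℝ) ^ 2 := by
  have hn1 : (1 : ℝ) ≤ n := Nat.one_le_cast.2 (Nat.one_le_iff_ne_zero.2 hn)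
  have hsum := integral_norm_sum_centeredIndicator_pow_four_le (fun τ : Fin n => hx τ)
    (fun τ => hlaw τ) (hindep.precomp Fin.val_injective) Finset.univ
  rw [Finset.card_fin] at hsum
  simp_rw [toLp_empiricalFreq_sub_toLp hn, norm_smul, mul_pow]
  rw [integral_const_mul]
  calc ‖(n : ℝ)⁻¹‖ ^ 4 * ∫ ω, ‖∑ τ : Fin n, centeredIndicator μ (x τ ω)‖ ^ 4 ∂P
      ≤ ‖(n : ℝ)⁻¹‖ ^ 4 * (5 * (n : ℝ) ^ 2) := by
        gcongr
        nlinarith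
    _ = 5 / (n : ℝ) ^ 2 := by
        rw [norm_inv, Real.norm_natCast]
        field_simp

end CenteredIndicator

section Hoeffding

variable {Ω : Type*} [MeasurableSpace Ω] {P : Measure Ω}

theorem measureReal_sum_nonneg_le_exp {κ : Type*} {Z : κ → Ω → ℝ} {a b δ : ℝ}
    (h : iIndepFun Z P) (hZ : ∀ k, Measurable (Z k)) (hbdd : ∀ k ω, Z k ω ∈ Set.Icc a b)
    (hmean : ∀ k, ∫ ω, Z k ω ∂P = -δ) (hδ : 0 ≤ δ) (s : Finset κ) :
    P.real {ω | 0 ≤ ∑ k ∈ s, Z k ω} ≤ Real.exp (-(s.card * (2 * δ ^ 2 / (b - a) ^ 2))) := by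
  have := h.isProbabilityMeasure
  have hind : iIndepFun (fun k ω => Z k ω - ∫ ω', Z k ω' ∂P) P :=
    h.comp (fun k z => z - ∫ ω, Z k ω ∂P) fun k => by fun_prop
  have hhoeff := HasSubgaussianMGF.measure_sum_ge_le_of_iIndepFun (s := s) hind
    (fun k _ => hasSubgaussianMGF_of_mem_Icc (hZ k).aemeasurable (.of_forall (hbdd k)))
    (mul_nonneg s.card.cast_nonneg hδ)
  have hevent : {ω | 0 ≤ ∑ k ∈ s, Z k ω} =
      {ω | s.card * δ ≤ ∑ k ∈ s, (Z k ω - ∫ ω', Z k ω' ∂P)} := by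
    ext ω
    simp [hmean, Finset.sum_add_distrib]
  rw [hevent]
  refine hhoeff.trans_eq (congrArg Real.exp ?_)
  simp only [Finset.sum_const, nsmul_eq_mul, NNReal.coe_mul, NNReal.coe_natCast, NNReal.coe_pow,
    NNReal.coe_div, coe_nnnorm, NNReal.coe_ofNat, div_pow, Real.norm_eq_abs, sq_abs]
  rcases s.card.eq_zero_or_pos with hs | hs
  · simp [hs]
  rcases eq_or_ne (b - a) 0 with hab | hab
  · simp [hab]
  · field_simp

theorem empiricalFreq_le_empiricalFreq_iff {L n : ℕ} (h : Fin n → Fin L) (i j : Fin L) :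
    empiricalFreq h i ≤ empiricalFreq h j ↔
      0 ≤ ∑ τ, ((if h τ = j then (1 : ℝ) else 0) - if h τ = i then 1 else 0) := by
  rw [Finset.sum_sub_distrib, sub_nonneg, empiricalFreq, empiricalFreq]
  rcases Nat.eq_zero_or_pos n with rfl | hn
  · simp
  · exact mul_le_mul_iff_right₀ (by positivity)

theorem measureReal_empiricalFreq_le_le_exp {L : ℕ} {μ : Fin L → ℝ} {x : ℕ → Ω → Fin L}
    (hx : ∀ k, Measurable (x k)) (hlaw : ∀ k i, P.real {ω | x k ω = i} = μ i)
    (hindep : iIndepFun x P) {i j : Fin L} (hij : μ j ≤ μ i) (n : ℕ) :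
    P.real {ω | empiricalFreq (fun τ : Fin n => x τ ω) i ≤
      empiricalFreq (fun τ : Fin n => x τ ω) j} ≤ Real.exp (-(n * ((μ i - μ j) ^ 2 / 2))) := by
  have := hindep.isProbabilityMeasure
  let f : Fin L → ℝ := fun k => (if k = j then 1 else 0) - if k = i then 1 else 0
  have hf : Measurable f := measurable_of_finite _
  have hmean : ∀ k, ∫ ω, f (x k ω) ∂P = -(μ i - μ j) := fun k => by
    rw [integral_comp_eq_sum_smul (hx k)]
    simp_rw [hlaw]
    simp [f, mul_sub]
  have hbdd : ∀ k, f k ∈ Set.Icc (-1) 1 := fun k => by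
    dsimp only [f]
    constructor <;> split_ifs <;> norm_num
  have hhoeff := measureReal_sum_nonneg_le_exp
    ((hindep.precomp Fin.val_injective).comp (fun _ : Fin n => f) fun _ => hf)
    (fun τ => hf.comp (hx τ)) (fun τ ω => hbdd (x τ ω)) (fun τ => hmean τ)
    (sub_nonneg.2 hij) Finset.univ
  simp_rw [empiricalFreq_le_empiricalFreq_iff]
  refine hhoeff.trans_eq ?_
  rw [Finset.card_fin]
  ring_nf

end Hoeffding

section Cache

variable {L C : ℕ}

theorem mem_optimalCache {i : Fin L} : i ∈ optimalCache L C ↔ i.val < C := by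
  simp [optimalCache]

theorem card_optimalCache (hCL : C ≤ L) : (optimalCache L C).card = C := by
  simp [optimalCache, Fin.card_filter_val_lt, hCL]

/-- The loss in hit probability, for one request of law `μ`, when the cache is `S` instead of the
optimal one; its expectation at the LFU cache is the expected regret of one step. -/
def hitGap (μ : Fin L → ℝ) (C : ℕ) (S : Finset (Fin L)) : ℝ :=
  ∑ i ∈ optimalCache L C, μ i - ∑ i ∈ S, μ i

variable {μ v : Fin L → ℝ} {S : Finset (Fin L)} {Δ : ℝ}

theorem sum_mul_indicator_sub_eq_hitGap (μ : Fin L → ℝ) (C : ℕ) (S : Finset (Fin L)) :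
    ∑ i, μ i * ((if i ∈ optimalCache L C then 1 else 0) - if i ∈ S then 1 else 0) =
      hitGap μ C S := by
  simp [hitGap, mul_sub]

theorem hitGap_le_one (hμ0 : ∀ i, 0 ≤ μ i) (hμ1 : ∑ i, μ i = 1) (S : Finset (Fin L)) :
    hitGap μ C S ≤ 1 := by
  calc hitGap μ C S ≤ ∑ i ∈ optimalCache L C, μ i :=
        sub_le_self _ (Finset.sum_nonneg fun i _ => hμ0 i)
    _ ≤ ∑ i, μ i :=
        Finset.sum_le_sum_of_subset_of_nonneg (Finset.subset_univ _) fun i _ _ => hμ0 i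
    _ = 1 := hμ1

-- A bijection from the missed items to the wrongly cached ones pairs up the losses; summing over
-- all pairs instead frees the bound from the choice of bijection.
theorem hitGap_le_sum_sdiff (hCL : C ≤ L) (hS : S.card = C)
    (hμ : ∀ i ∈ optimalCache L C, ∀ j ∉ optimalCache L C, μ j ≤ μ i) :
    hitGap μ C S ≤
      ∑ i ∈ optimalCache L C \ S, ∑ j ∈ S \ optimalCache L C, (μ i - μ j) := by
  let e : ↥(optimalCache L C \ S) ≃ ↥(S \ optimalCache L C) :=
    Finset.equivOfCardEq (Finset.card_sdiff_comm (by rw [card_optimalCache hCL, hS]))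
  calc hitGap μ C S
      = ∑ i ∈ optimalCache L C \ S, μ i - ∑ j ∈ S \ optimalCache L C, μ j :=
        (Finset.sum_sdiff_sub_sum_sdiff ..).symm
    _ = ∑ i : ↥(optimalCache L C \ S), (μ i - μ (e i)) := by
        rw [Finset.sum_sub_distrib, e.sum_comp fun j => μ j, Finset.sum_coe_sort,
          Finset.sum_coe_sort]
    _ ≤ ∑ i : ↥(optimalCache L C \ S), ∑ j ∈ S \ optimalCache L C, (μ i - μ j) :=
        Finset.sum_le_sum fun i _ => Finset.single_le_sum (f := fun j => μ i - μ j)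
          (fun j hj => sub_nonneg.2 <|
            hμ i (Finset.mem_sdiff.1 i.2).1 j (Finset.mem_sdiff.1 hj).2) (e i).2
    _ = _ := Finset.sum_coe_sort _ fun i => ∑ j ∈ S \ optimalCache L C, (μ i - μ j)

theorem IsTopSet.hitGap_le_sum_inversions (hS : IsTopSet C v S) (hCL : C ≤ L)
    (hμ : ∀ i ∈ optimalCache L C, ∀ j ∉ optimalCache L C, μ j ≤ μ i) :
    hitGap μ C S ≤ ∑ i ∈ optimalCache L C, ∑ j ∈ (optimalCache L C)ᶜ,
      (μ i - μ j) * if v i ≤ v j then 1 else 0 := by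
  have hterm : ∀ i ∈ optimalCache L C, ∀ j ∈ (optimalCache L C)ᶜ,
      0 ≤ (μ i - μ j) * if v i ≤ v j then 1 else 0 := fun i hi j hj =>
    mul_nonneg (sub_nonneg.2 (hμ i hi j (Finset.mem_compl.1 hj))) (by split_ifs <;> norm_num)
  have hsub : S \ optimalCache L C ⊆ (optimalCache L C)ᶜ := fun j hj =>
    Finset.mem_compl.2 (Finset.mem_sdiff.1 hj).2
  calc hitGap μ C S
      ≤ ∑ i ∈ optimalCache L C \ S, ∑ j ∈ S \ optimalCache L C, (μ i - μ j) :=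
        hitGap_le_sum_sdiff hCL hS.1 hμ
    _ = ∑ i ∈ optimalCache L C \ S, ∑ j ∈ S \ optimalCache L C,
          (μ i - μ j) * if v i ≤ v j then 1 else 0 :=
        Finset.sum_congr rfl fun i hi => Finset.sum_congr rfl fun j hj => by
          rw [if_pos (hS.2 j (Finset.mem_sdiff.1 hj).1 i (Finset.mem_sdiff.1 hi).2), mul_one]
    _ ≤ ∑ i ∈ optimalCache L C \ S, ∑ j ∈ (optimalCache L C)ᶜ,
          (μ i - μ j) * if v i ≤ v j then 1 else 0 :=
        Finset.sum_le_sum fun i hi => Finset.sum_le_sum_of_subset_of_nonneg hsub fun j hj _ =>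
          hterm i (Finset.mem_sdiff.1 hi).1 j hj
    _ ≤ _ :=
        Finset.sum_le_sum_of_subset_of_nonneg Finset.sdiff_subset fun i hi _ =>
          Finset.sum_nonneg (hterm i hi)

theorem sq_sub_le_two_mul_norm_sq {ι : Type*} [Fintype ι] (w : EuclideanSpace ℝ ι) (i j : ι) :
    (w i - w j) ^ 2 ≤ 2 * ‖w‖ ^ 2 := by
  rcases eq_or_ne i j with rfl | hij
  · rw [sub_self, zero_pow two_ne_zero]
    positivity
  · have hpair : w i ^ 2 + w j ^ 2 ≤ ‖w‖ ^ 2 := by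
      rw [EuclideanSpace.real_norm_sq_eq]
      exact Finset.add_le_sum (fun k _ => sq_nonneg (w k)) (Finset.mem_univ i)
        (Finset.mem_univ j) hij
    linarith [sq_nonneg (w i + w j)]

theorem IsTopSet.sq_le_two_mul_norm_sq (hS : IsTopSet C v S) (hCL : C ≤ L)
    (hne : S ≠ optimalCache L C) (hΔ : 0 ≤ Δ)
    (hgap : ∀ i ∈ optimalCache L C, ∀ j ∉ optimalCache L C, Δ ≤ μ i - μ j) :
    Δ ^ 2 ≤ 2 * ‖WithLp.toLp 2 v - WithLp.toLp 2 μ‖ ^ 2 := by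
  have hcard : S.card = (optimalCache L C).card := by rw [card_optimalCache hCL, hS.1]
  obtain ⟨j, hjS, hjO⟩ := Finset.not_subset.1 fun hsub =>
    hne (Finset.eq_of_subset_of_card_le hsub hcard.ge)
  obtain ⟨i, hiO, hiS⟩ := Finset.not_subset.1 fun hsub =>
    hne (Finset.eq_of_subset_of_card_le hsub hcard.le).symm
  have hdev : Δ ≤ (v j - μ j) - (v i - μ i) := by
    linarith [hgap i hiO j hjO, hS.2 j hjS i hiS]
  exact (pow_le_pow_left₀ hΔ hdev 2).trans
    (sq_sub_le_two_mul_norm_sq (WithLp.toLp 2 v - WithLp.toLp 2 μ) j i)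

theorem IsTopSet.hitGap_le_norm_pow_four (hS : IsTopSet C v S) (hCL : C ≤ L)
    (hμ0 : ∀ i, 0 ≤ μ i) (hμ1 : ∑ i, μ i = 1) (hΔ : 0 < Δ)
    (hgap : ∀ i ∈ optimalCache L C, ∀ j ∉ optimalCache L C, Δ ≤ μ i - μ j) :
    hitGap μ C S ≤ 4 / Δ ^ 4 * ‖WithLp.toLp 2 v - WithLp.toLp 2 μ‖ ^ 4 := by
  rcases eq_or_ne S (optimalCache L C) with rfl | hne
  · rw [hitGap, sub_self]
    positivity
  · refine (hitGap_le_one hμ0 hμ1 S).trans ?_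
    have hsq := pow_le_pow_left₀ (sq_nonneg Δ) (hS.sq_le_two_mul_norm_sq hCL hne hΔ.le hgap) 2
    rw [div_mul_eq_mul_div, one_le_div (by positivity)]
    linarith

end Cache

section Policy

variable {Ω : Type*} [MeasurableSpace Ω] {P : Measure Ω} {𝓤 : Type*} [MeasurableSpace 𝓤]
  {L C : ℕ} {μ : Fin L → ℝ} {x : ℕ → Ω → Fin L} {U : Ω → 𝓤} {π : CachingPolicy L 𝓤}

theorem indepFun_past {α : Type*} [MeasurableSpace α] {x : ℕ → Ω → α}
    (hx : ∀ n, Measurable (x n)) (hindep : iIndepFun x P) (n : ℕ) :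
    IndepFun (fun ω (τ : Fin n) => x τ ω) (x n) P := by
  have h := hindep.indepFun_finset (Finset.range n) {n} (by simp) hx
  have hlast : Measurable fun a : ({n} : Finset ℕ) → α => a ⟨n, Finset.mem_singleton_self n⟩ :=
    measurable_pi_apply _
  exact h.comp (φ := fun a (τ : Fin n) => a ⟨τ, Finset.mem_range.2 τ.2⟩)
    (by fun_prop) hlast

theorem indepFun_seed_past [IsProbabilityMeasure P] {α : Type*} [MeasurableSpace α]
    {x : ℕ → Ω → α} (hx : ∀ n, Measurable (x n)) (hindep : iIndepFun x P) (hU : Measurable U)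
    (hUx : IndepFun U (fun ω n => x n ω) P) (n : ℕ) :
    IndepFun (fun ω => (U ω, fun τ : Fin n => x τ ω)) (x n) P := by
  refine indepFun_prodMk_left_of_indepFun_prodMk_right hU (by fun_prop) (hx n) ?_
    (indepFun_past hx hindep n)
  exact hUx.comp (ψ := fun a : ℕ → α => (fun τ : Fin n => a τ, a n)) measurable_id (by fun_prop)

theorem IsLFU.measurable_policy (hπ : IsLFU C π) (n : ℕ) :
    Measurable fun p : 𝓤 × (Fin n → Fin L) => π n p.2 p.1 :=
  measurable_from_prod_countable_left fun h => measurable_to_countable' fun S =>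
    hπ.measurable n h S

theorem IsLFU.measurable_cacheAt (hπ : IsLFU C π) (hx : ∀ n, Measurable (x n))
    (hU : Measurable U) (n : ℕ) : Measurable fun ω => cacheAt π (U ω) (fun k => x k ω) n :=
  (hπ.measurable_policy n).comp (g := fun p : 𝓤 × (Fin n → Fin L) => π n p.2 p.1)
    (f := fun ω => (U ω, fun τ : Fin n => x τ ω)) (by fun_prop)

variable [IsProbabilityMeasure P]

theorem IsLFU.indepFun_cacheAt (hπ : IsLFU C π) (hx : ∀ n, Measurable (x n))
    (hindep : iIndepFun x P) (hU : Measurable U) (hUx : IndepFun U (fun ω n => x n ω) P) (n : ℕ) :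
    IndepFun (fun ω => cacheAt π (U ω) (fun k => x k ω) n) (x n) P :=
  (indepFun_seed_past hx hindep hU hUx n).comp (hπ.measurable_policy n) measurable_id

theorem IsLFU.integrable_regret_step (hπ : IsLFU C π) (hx : ∀ n, Measurable (x n))
    (hU : Measurable U) (n : ℕ) :
    Integrable (fun ω => (if x n ω ∈ optimalCache L C then (1 : ℝ) else 0) -
      if x n ω ∈ cacheAt π (U ω) (fun k => x k ω) n then 1 else 0) P :=
  integrable_comp_of_finite ((hπ.measurable_cacheAt hx hU n).prodMk (hx n))
    fun p => (if p.2 ∈ optimalCache L C then (1 : ℝ) else 0) - if p.2 ∈ p.1 then 1 else 0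

theorem IsLFU.integrable_regret (hπ : IsLFU C π) (hx : ∀ n, Measurable (x n)) (hU : Measurable U)
    (T : ℕ) : Integrable (fun ω => regret C π (U ω) (fun n => x n ω) T) P :=
  integrable_finsetSum _ fun n _ => hπ.integrable_regret_step hx hU n

theorem IsLFU.integral_regret (hπ : IsLFU C π) (hx : ∀ n, Measurable (x n))
    (hlaw : ∀ n i, P.real {ω | x n ω = i} = μ i) (hindep : iIndepFun x P) (hU : Measurable U)
    (hUx : IndepFun U (fun ω n => x n ω) P) (T : ℕ) :
    ∫ ω, regret C π (U ω) (fun n => x n ω) T ∂P =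
      ∑ n ∈ Finset.range T, ∫ ω, hitGap μ C (cacheAt π (U ω) (fun k => x k ω) n) ∂P := by
  simp_rw [regret]
  rw [integral_finsetSum _ fun n _ => hπ.integrable_regret_step hx hU n]
  refine Finset.sum_congr rfl fun n _ => ?_
  rw [integral_comp_comp_eq_integral_sum_smul_of_indepFun
    (hπ.indepFun_cacheAt hx hindep hU hUx n) (hπ.measurable_cacheAt hx hU n) (hx n)
    fun S i => (if i ∈ optimalCache L C then (1 : ℝ) else 0) - if i ∈ S then 1 else 0]
  simp_rw [hlaw, smul_eq_mul, sum_mul_indicator_sub_eq_hitGap]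

theorem IsLFU.integrable_hitGap (hπ : IsLFU C π) (hx : ∀ n, Measurable (x n))
    (hU : Measurable U) (n : ℕ) :
    Integrable (fun ω => hitGap μ C (cacheAt π (U ω) (fun k => x k ω) n)) P :=
  integrable_comp_of_finite (hπ.measurable_cacheAt hx hU n) (hitGap μ C)

theorem IsLFU.integral_hitGap_le_one (hπ : IsLFU C π) (hx : ∀ n, Measurable (x n))
    (hμ0 : ∀ i, 0 ≤ μ i) (hμ1 : ∑ i, μ i = 1) (hU : Measurable U) (n : ℕ) :
    ∫ ω, hitGap μ C (cacheAt π (U ω) (fun k => x k ω) n) ∂P ≤ 1 := by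
  simpa using integral_mono (hπ.integrable_hitGap hx hU n) (integrable_const (μ := P) (1 : ℝ))
    fun ω => hitGap_le_one hμ0 hμ1 (cacheAt π (U ω) (fun k => x k ω) n)

theorem IsLFU.integral_hitGap_le_inv_sq (hπ : IsLFU C π) (hCL : C ≤ L)
    (hx : ∀ n, Measurable (x n)) (hlaw : ∀ n i, P.real {ω | x n ω = i} = μ i)
    (hindep : iIndepFun x P) (hU : Measurable U) {Δ : ℝ} (hΔ : 0 < Δ)
    (hgap : ∀ i ∈ optimalCache L C, ∀ j ∉ optimalCache L C, Δ ≤ μ i - μ j) {n : ℕ} (hn : n ≠ 0) :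
    ∫ ω, hitGap μ C (cacheAt π (U ω) (fun k => x k ω) n) ∂P ≤ 20 / Δ ^ 4 / (n : ℝ) ^ 2 := by
  have hμ0 : ∀ i, 0 ≤ μ i := fun i => hlaw 0 i ▸ measureReal_nonneg
  have hμ1 : ∑ i, μ i = 1 := by simpa only [hlaw] using sum_measureReal_eq_one (P := P) (hx 0)
  have hpast : Measurable fun ω (τ : Fin n) => x τ ω := by fun_prop
  calc ∫ ω, hitGap μ C (cacheAt π (U ω) (fun k => x k ω) n) ∂P
      ≤ ∫ ω, 4 / Δ ^ 4 *
          ‖WithLp.toLp 2 (empiricalFreq fun τ : Fin n => x τ ω) - WithLp.toLp 2 μ‖ ^ 4 ∂P :=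
        integral_mono (hπ.integrable_hitGap hx hU n)
          (integrable_comp_of_finite hpast fun h =>
            4 / Δ ^ 4 * ‖WithLp.toLp 2 (empiricalFreq h) - WithLp.toLp 2 μ‖ ^ 4)
          fun ω => (hπ.top _ _ _).hitGap_le_norm_pow_four hCL hμ0 hμ1 hΔ hgap
    _ ≤ 4 / Δ ^ 4 * (5 / (n : ℝ) ^ 2) := by
        rw [integral_const_mul]
        gcongr
        exact integral_norm_empiricalFreq_sub_pow_four_le hx hlaw hindep hn
    _ = 20 / Δ ^ 4 / (n : ℝ) ^ 2 := by ring

theorem IsLFU.integral_hitGap_le_sum_exp (hπ : IsLFU C π) (hCL : C ≤ L)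
    (hx : ∀ n, Measurable (x n)) (hlaw : ∀ n i, P.real {ω | x n ω = i} = μ i)
    (hindep : iIndepFun x P) (hU : Measurable U)
    (hμ : ∀ i ∈ optimalCache L C, ∀ j ∉ optimalCache L C, μ j ≤ μ i) (n : ℕ) :
    ∫ ω, hitGap μ C (cacheAt π (U ω) (fun k => x k ω) n) ∂P ≤
      ∑ i ∈ optimalCache L C, ∑ j ∈ (optimalCache L C)ᶜ,
        (μ i - μ j) * Real.exp (-(n * ((μ i - μ j) ^ 2 / 2))) := by
  have hpast : Measurable fun ω (τ : Fin n) => x τ ω := by fun_prop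
  have hint : ∀ G : (Fin n → Fin L) → ℝ, Integrable (fun ω => G fun τ => x τ ω) P := fun G =>
    integrable_comp_of_finite hpast G
  calc ∫ ω, hitGap μ C (cacheAt π (U ω) (fun k => x k ω) n) ∂P
      ≤ ∫ ω, ∑ i ∈ optimalCache L C, ∑ j ∈ (optimalCache L C)ᶜ, (μ i - μ j) *
          (if empiricalFreq (fun τ : Fin n => x τ ω) i ≤
            empiricalFreq (fun τ : Fin n => x τ ω) j then 1 else 0) ∂P :=
        integral_mono (hπ.integrable_hitGap hx hU n)
          (hint fun h => ∑ i ∈ optimalCache L C, ∑ j ∈ (optimalCache L C)ᶜ, (μ i - μ j) *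
            (if empiricalFreq h i ≤ empiricalFreq h j then 1 else 0))
          fun ω => (hπ.top _ _ _).hitGap_le_sum_inversions hCL hμ
    _ = ∑ i ∈ optimalCache L C, ∑ j ∈ (optimalCache L C)ᶜ, (μ i - μ j) *
          P.real {ω | empiricalFreq (fun τ : Fin n => x τ ω) i ≤
            empiricalFreq (fun τ : Fin n => x τ ω) j} :=
        integral_sum_sum_mul_ite _ _ _ fun i j =>
          hpast (Set.toFinite {h | empiricalFreq h i ≤ empiricalFreq h j}).measurableSet
    _ ≤ _ :=
        Finset.sum_le_sum fun i hi => Finset.sum_le_sum fun j hj =>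
          have hji := hμ i hi j (Finset.mem_compl.1 hj)
          mul_le_mul_of_nonneg_left
            (measureReal_empiricalFreq_le_le_exp hx hlaw hindep hji n) (sub_nonneg.2 hji)

end Policy

section Series

theorem sum_range_le_of_le_sq_div_sq {a : ℕ → ℝ} {c : ℝ} (hc : 0 ≤ c) (h_one : ∀ n, a n ≤ 1)
    (h_sq : ∀ n, n ≠ 0 → a n ≤ c ^ 2 / (n : ℝ) ^ 2) (T : ℕ) :
    ∑ n ∈ Finset.range T, a n ≤ 3 * c + 1 := by
  have hfloor : (⌊c⌋₊ : ℝ) ≤ c := Nat.floor_le hc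
  have hhead : ∑ n ∈ Finset.range T with n ≤ ⌊c⌋₊, a n ≤ c + 1 := by
    have hsub : (Finset.range T).filter (· ≤ ⌊c⌋₊) ⊆ Finset.range (⌊c⌋₊ + 1) := fun n hn =>
      Finset.mem_range_succ_iff.2 (Finset.mem_filter.1 hn).2
    have hcard : (((Finset.range T).filter (· ≤ ⌊c⌋₊)).card : ℝ) ≤ ⌊c⌋₊ + 1 := by
      exact_mod_cast (Finset.card_le_card hsub).trans_eq (Finset.card_range _)
    have hsum := Finset.sum_le_card_nsmul ((Finset.range T).filter (· ≤ ⌊c⌋₊)) a 1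
      fun n _ => h_one n
    rw [nsmul_one] at hsum
    linarith
  have htail : ∑ n ∈ Finset.range T with ¬n ≤ ⌊c⌋₊, a n ≤ 2 * c := by
    have hIoo : (Finset.range T).filter (¬· ≤ ⌊c⌋₊) = Finset.Ioo ⌊c⌋₊ T := by
      ext n
      simp [and_comm]
    calc ∑ n ∈ Finset.range T with ¬n ≤ ⌊c⌋₊, a n
        ≤ ∑ n ∈ Finset.Ioo ⌊c⌋₊ T, c ^ 2 * ((n : ℝ) ^ 2)⁻¹ := by
          rw [hIoo]
          exact Finset.sum_le_sum fun n hn =>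
            (h_sq n (Nat.ne_zero_of_lt (Finset.mem_Ioo.1 hn).1)).trans_eq (div_eq_mul_inv _ _)
      _ ≤ c ^ 2 * (2 / (⌊c⌋₊ + 1)) := by
          rw [← Finset.mul_sum]
          gcongr
          exact sum_Ioo_inv_sq_le _ _
      _ ≤ 2 * c := by
          rw [mul_div_assoc', div_le_iff₀ (by positivity)]
          nlinarith [Nat.lt_floor_add_one c]
  rw [← Finset.sum_filter_add_sum_filter_not (Finset.range T) (· ≤ ⌊c⌋₊)]
  linarith

theorem sum_range_exp_neg_mul_le {a : ℝ} (ha : 0 < a) (T : ℕ) :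
    ∑ n ∈ Finset.range T, Real.exp (-(n * a)) ≤ 1 + 1 / a := by
  have hinv : 1 - (a + 1)⁻¹ = a / (a + 1) := by
    field_simp
    ring
  have hlt : Real.exp (-a) < 1 := Real.exp_lt_one_iff.2 (neg_neg_of_pos ha)
  have hexp : Real.exp (-a) ≤ (a + 1)⁻¹ := by
    rw [Real.exp_neg]
    gcongr
    exact Real.add_one_le_exp a
  calc ∑ n ∈ Finset.range T, Real.exp (-(n * a)) = ∑ n ∈ Finset.range T, Real.exp (-a) ^ n := by
        simp_rw [← Real.exp_nat_mul, mul_neg]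
    _ ≤ ∑' n, Real.exp (-a) ^ n :=
        (summable_geometric_of_lt_one (Real.exp_nonneg _) hlt).sum_le_tsum _
          fun n _ => pow_nonneg (Real.exp_nonneg _) n
    _ = (1 - Real.exp (-a))⁻¹ := tsum_geometric_of_lt_one (Real.exp_nonneg _) hlt
    _ ≤ (1 - (a + 1)⁻¹)⁻¹ := by
        gcongr
        exact sub_pos.2 (inv_lt_one_of_one_lt₀ (by linarith))
    _ = 1 + 1 / a := by rw [hinv, inv_div, add_div, div_self ha.ne']

end Series

section RegretBounds

variable {Ω : Type*} [MeasurableSpace Ω] {P : Measure Ω} [IsProbabilityMeasure P]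
  {𝓤 : Type*} [MeasurableSpace 𝓤] {L C : ℕ} {μ : Fin L → ℝ} {x : ℕ → Ω → Fin L} {U : Ω → 𝓤}
  {π : CachingPolicy L 𝓤} {Δ : ℝ}

theorem sub_le_one_of_sum_eq_one {ι : Type*} [Fintype ι] {μ : ι → ℝ} (hμ0 : ∀ i, 0 ≤ μ i)
    (hμ1 : ∑ i, μ i = 1) (i j : ι) : μ i - μ j ≤ 1 :=
  (sub_le_self _ (hμ0 j)).trans
    (hμ1 ▸ Finset.single_le_sum (fun k _ => hμ0 k) (Finset.mem_univ i))

theorem gap_le_one (hC : 1 ≤ C) (hCL : C < L) (hμ0 : ∀ i, 0 ≤ μ i) (hμ1 : ∑ i, μ i = 1)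
    (hgap : ∀ i ∈ optimalCache L C, ∀ j ∉ optimalCache L C, Δ ≤ μ i - μ j) : Δ ≤ 1 :=
  (hgap ⟨0, by omega⟩ (mem_optimalCache.2 hC) ⟨C, hCL⟩
    (mem_optimalCache.not.2 (lt_irrefl C))).trans (sub_le_one_of_sum_eq_one hμ0 hμ1 _ _)

theorem IsLFU.integral_regret_lt_div_sq (hπ : IsLFU C π) (hC : 1 ≤ C) (hCL : C < L)
    (hx : ∀ n, Measurable (x n)) (hlaw : ∀ n i, P.real {ω | x n ω = i} = μ i)
    (hindep : iIndepFun x P) (hU : Measurable U) (hUx : IndepFun U (fun ω n => x n ω) P)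
    (hΔ : 0 < Δ) (hgap : ∀ i ∈ optimalCache L C, ∀ j ∉ optimalCache L C, Δ ≤ μ i - μ j) (T : ℕ) :
    ∫ ω, regret C π (U ω) (fun n => x n ω) T ∂P < 16 / Δ ^ 2 := by
  have hμ0 : ∀ i, 0 ≤ μ i := fun i => hlaw 0 i ▸ measureReal_nonneg
  have hμ1 : ∑ i, μ i = 1 := by simpa only [hlaw] using sum_measureReal_eq_one (P := P) (hx 0)
  have hΔ1 : 1 ≤ 1 / Δ ^ 2 := by
    rw [one_le_div (by positivity)]
    exact pow_le_one₀ hΔ.le (gap_le_one hC hCL hμ0 hμ1 hgap)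
  have hsq : ∀ n, n ≠ 0 → ∫ ω, hitGap μ C (cacheAt π (U ω) (fun k => x k ω) n) ∂P ≤
      (9 / 2 / Δ ^ 2) ^ 2 / (n : ℝ) ^ 2 := fun n hn => by
    refine (hπ.integral_hitGap_le_inv_sq hCL.le hx hlaw hindep hU hΔ hgap hn).trans ?_
    -- `9 / 2` is large enough for `20 ≤ (9 / 2) ^ 2` and small enough for `3 * (9 / 2) + 1 < 16`.
    rw [div_pow, ← pow_mul]
    gcongr
    norm_num
  rw [hπ.integral_regret hx hlaw hindep hU hUx]
  calc ∑ n ∈ Finset.range T, ∫ ω, hitGap μ C (cacheAt π (U ω) (fun k => x k ω) n) ∂P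
      ≤ 3 * (9 / 2 / Δ ^ 2) + 1 :=
        sum_range_le_of_le_sq_div_sq (by positivity) (hπ.integral_hitGap_le_one hx hμ0 hμ1 hU)
          hsq T
    _ = 27 / 2 * (1 / Δ ^ 2) + 1 := by ring
    _ < 16 * (1 / Δ ^ 2) := by linarith
    _ = 16 / Δ ^ 2 := by ring

theorem sum_range_mul_exp_le {d : ℝ} (hΔ : 0 < Δ) (hΔd : Δ ≤ d) (hd1 : d ≤ 1) (T : ℕ) :
    ∑ n ∈ Finset.range T, d * Real.exp (-(n * (d ^ 2 / 2))) ≤ 3 / Δ := by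
  have hd : 0 < d := hΔ.trans_le hΔd
  calc ∑ n ∈ Finset.range T, d * Real.exp (-(n * (d ^ 2 / 2)))
      ≤ d * (1 + 1 / (d ^ 2 / 2)) := by
        rw [← Finset.mul_sum]
        gcongr
        exact sum_range_exp_neg_mul_le (by positivity) T
    _ = (d ^ 2 + 2) / d := by field_simp
    _ ≤ 3 / d := by
        gcongr
        linarith [pow_le_one₀ (n := 2) hd.le hd1]
    _ ≤ 3 / Δ := by gcongr

theorem IsLFU.integral_regret_lt_pairs_div (hπ : IsLFU C π) (hC : 1 ≤ C) (hCL : C < L)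
    (hx : ∀ n, Measurable (x n)) (hlaw : ∀ n i, P.real {ω | x n ω = i} = μ i)
    (hindep : iIndepFun x P) (hU : Measurable U) (hUx : IndepFun U (fun ω n => x n ω) P)
    (hΔ : 0 < Δ) (hgap : ∀ i ∈ optimalCache L C, ∀ j ∉ optimalCache L C, Δ ≤ μ i - μ j) (T : ℕ) :
    ∫ ω, regret C π (U ω) (fun n => x n ω) T ∂P < 4 * (C : ℝ) * ((L : ℝ) - C) / Δ := by
  have hμ0 : ∀ i, 0 ≤ μ i := fun i => hlaw 0 i ▸ measureReal_nonneg
  have hμ1 : ∑ i, μ i = 1 := by simpa only [hlaw] using sum_measureReal_eq_one (P := P) (hx 0)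
  have hμ : ∀ i ∈ optimalCache L C, ∀ j ∉ optimalCache L C, μ j ≤ μ i := fun i hi j hj =>
    sub_nonneg.1 (hΔ.le.trans (hgap i hi j hj))
  have hcompl : ((optimalCache L C)ᶜ.card : ℝ) = L - C := by
    rw [Finset.card_compl, card_optimalCache hCL.le, Fintype.card_fin, Nat.cast_sub hCL.le]
  have hC0 : (0 : ℝ) < C := Nat.cast_pos.2 hC
  have hLC : (0 : ℝ) < L - C := sub_pos.2 (Nat.cast_lt.2 hCL)
  rw [hπ.integral_regret hx hlaw hindep hU hUx]
  calc ∑ n ∈ Finset.range T, ∫ ω, hitGap μ C (cacheAt π (U ω) (fun k => x k ω) n) ∂P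
      ≤ ∑ n ∈ Finset.range T, ∑ i ∈ optimalCache L C, ∑ j ∈ (optimalCache L C)ᶜ,
          (μ i - μ j) * Real.exp (-(n * ((μ i - μ j) ^ 2 / 2))) :=
        Finset.sum_le_sum fun n _ =>
          hπ.integral_hitGap_le_sum_exp hCL.le hx hlaw hindep hU hμ n
    _ = ∑ i ∈ optimalCache L C, ∑ j ∈ (optimalCache L C)ᶜ, ∑ n ∈ Finset.range T,
          (μ i - μ j) * Real.exp (-(n * ((μ i - μ j) ^ 2 / 2))) := by
        rw [Finset.sum_comm]
        exact Finset.sum_congr rfl fun i _ => Finset.sum_comm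
    _ ≤ ∑ i ∈ optimalCache L C, ∑ j ∈ (optimalCache L C)ᶜ, 3 / Δ :=
        Finset.sum_le_sum fun i hi => Finset.sum_le_sum fun j hj =>
          sum_range_mul_exp_le hΔ (hgap i hi j (Finset.mem_compl.1 hj))
            (sub_le_one_of_sum_eq_one hμ0 hμ1 i j) T
    _ = 3 * C * (L - C) / Δ := by
        simp only [Finset.sum_const, nsmul_eq_mul, hcompl, card_optimalCache hCL.le]
        ring
    _ < 4 * C * (L - C) / Δ :=
        div_lt_div_of_pos_right (by linarith [mul_pos hC0 hLC]) hΔ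

end RegretBounds

section DeltaMin

variable {L C : ℕ} {μ : Fin L → ℝ}

theorem deltaMin_pos (hμ : StrictAnti μ) (hC : 1 ≤ C) (hCL : C < L) : 0 < deltaMin μ C hCL :=
  sub_pos.2 (hμ (Fin.mk_lt_mk.2 (Nat.sub_one_lt_of_lt hC)))

theorem deltaMin_le_sub (hμ : Antitone μ) (hCL : C < L) {i j : Fin L}
    (hi : i ∈ optimalCache L C) (hj : j ∉ optimalCache L C) :
    deltaMin μ C hCL ≤ μ i - μ j := by
  rw [mem_optimalCache] at hi hj
  exact sub_le_sub (hμ (Fin.le_def.2 (Nat.le_sub_one_of_lt hi)))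
    (hμ (Fin.le_def.2 (not_lt.1 hj)))

end DeltaMin

theorem theorem1_general {Ω : Type*} [MeasurableSpace Ω] {P : Measure Ω} [IsProbabilityMeasure P]
    {𝓤 : Type*} [MeasurableSpace 𝓤] {L C : ℕ} (hC : 1 ≤ C) (hCL : C < L)
    {μ : Fin L → ℝ} {Δ : ℝ} (hΔ : 0 < Δ)
    (hgap : ∀ i ∈ optimalCache L C, ∀ j ∉ optimalCache L C, Δ ≤ μ i - μ j)
    {x : ℕ → Ω → Fin L} (hx_meas : ∀ n, Measurable (x n))
    (hx_law : ∀ n i, P.real {ω | x n ω = i} = μ i) (hx_indep : iIndepFun x P)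
    {U : Ω → 𝓤} (hU_meas : Measurable U) (hU_indep : IndepFun U (fun ω n => x n ω) P)
    {π : CachingPolicy L 𝓤} (hπ : IsLFU C π) (T : ℕ) :
    Integrable (fun ω => regret C π (U ω) (fun n => x n ω) T) P ∧
      ∫ ω, regret C π (U ω) (fun n => x n ω) T ∂P <
        min (16 / Δ ^ 2) (4 * (C : ℝ) * ((L : ℝ) - (C : ℝ)) / Δ) :=
  ⟨hπ.integrable_regret hx_meas hU_meas T, lt_min
    (hπ.integral_regret_lt_div_sq hC hCL hx_meas hx_law hx_indep hU_meas hU_indep hΔ hgap T)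
    (hπ.integral_regret_lt_pairs_div hC hCL hx_meas hx_law hx_indep hU_meas hU_indep hΔ hgap T)⟩

theorem theorem1 {Ω : Type*} [MeasurableSpace Ω] (P : Measure Ω) [IsProbabilityMeasure P]
    {𝓤 : Type*} [MeasurableSpace 𝓤]
    (L C : ℕ) (hC : 1 ≤ C) (hCL : C < L)
    (μ : Fin L → ℝ) (hμ_sum : ∑ i, μ i = 1) (hμ : StrictAnti μ)
    (x : ℕ → Ω → Fin L) (hx_meas : ∀ n, Measurable (x n))
    (hx_law : ∀ n i, P.real {ω | x n ω = i} = μ i)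
    (hx_indep : iIndepFun x P)
    (U : Ω → 𝓤) (hU_meas : Measurable U)
    (hU_indep : IndepFun U (fun ω n => x n ω) P)
    (π : CachingPolicy L 𝓤) (hπ : IsLFU C π) (T : ℕ) :
    Integrable (fun ω => regret C π (U ω) (fun n => x n ω) T) P ∧
      ∫ ω, regret C π (U ω) (fun n => x n ω) T ∂P <
        min (16 / deltaMin μ C hCL ^ 2)
          (4 * (C : ℝ) * ((L : ℝ) - (C : ℝ)) / deltaMin μ C hCL) :=
  theorem1_general hC hCL (deltaMin_pos hμ hC hCL)
    (fun _ hi _ hj => deltaMin_le_sub hμ.antitone hCL hi hj)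
    hx_meas hx_law hx_indep hU_meas hU_indep hπ T
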